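/- Let $d \ge 0$ be an integer, let $\mathbb{R}_{>0}=(0,\infty)$, let $\|\cdot\|$ be the Euclidean norm on $\mathbb{R}^d$, and let $\tau\odot\gamma$ denote the entrywise product of $\tau,\gamma\in\mathbb{R}^d$. A function $h:\mathbb{R}^d\to\mathbb{R}$ is called positive semi-definite if $(x,y)\mapsto h(x-y)$ is symmetric and $\sum_{i,j} c_i c_j h(x_i-x_j)\ge 0$ for all finite families $x_i\in\mathbb{R}^d$, $c_i\in\mathbb{R}$. A stationary real-valued kernel is a continuous positive semi-definite function $k:\mathbb{R}^d\to\mathbb{R}$ (of the lag $\tau=x-y$). A set $G$ of real functions on $\mathbb{R}^d$ is called dense in the stationary kernels if for every stationary real-valued kernel $k$ there is a sequence $g_n\in G$ with $g_n(\tau)\to k(\tau)$ for every $\tau\in\mathbb{R}^d$. For $h:\mathbb{R}^d\to\mathbb{R}$, $A\subseteq\mathbb{R}$ and $\Omega\subseteq\mathbb{R}^d$ let $\mathcal{S}(h;A,\Omega)$ be the set of all functions $$\tau\mapsto\sum_{k=1}^{K}\alpha_k\,h(\tau\odot\gamma_k)\cos(2\pi\,\omega_k^T\tau),\qquad K\ge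 1,\ \alpha_k\in A,\ \omega_k\in\Omega,\ \gamma_k\in\mathbb{R}_{>0}^d .$$ (i) If $h:\mathbb{R}^d\to\mathbb{R}$ is positive semi-definite, continuous, Lebesgue integrable, and $h(\tau)>0$ for all $\tau\in\mathbb{R}^d$, then $\mathcal{S}(h;\mathbb{R},\mathbb{R}_{>0}^d)$ is dense in the stationary kernels. (ii) Let $h$ be the Gaussian $h(\tau)=\exp(-2\pi^2\|\tau\|^2)$ (spectral mixture kernels), or, for some $\nu>0$, the Matérn kernel $$h(\tau)=\frac{1}{\Gamma(\nu)2^{\nu-1}}\left(\sqrt{2\nu}\,\|\tau\|\right)^{\nu}K_\nu\!\left(\sqrt{2\nu}\,\|\tau\|\right)\quad(\tau\ne 0),\qquad h(0)=1$$ (Matérn spectral kernels), where $K_\nu(x)=\int_0^\infty e^{-x\cosh t}\cosh(\nu t)\,dt$ is the modified Bessel function of the second kind. Then $\mathcal{S}(h;\mathbb{R},\mathbb{R}_{>0}^d)$ is dense in the stationary kernels; with positive coefficients, $\mathcal{S}(h;\mathbb{R}_{>0},\mathbb{R}^d)$ is dense in the stationary kernels; and if $d=1$, then also $\mathcal{S}(h;\mathbb{R}_{>0},\mathbb{R}_{>0})$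 is dense in the stationary kernels. -/

import Mathlib

noncomputable section

namespace SpectralKernels

/-- A real function `h` on `ℝ^d` is positive semi-definite if `(x, y) ↦ h (x - y)` is a symmetric
positive semi-definite kernel: for finitely supported real `c`,
`∑ x, ∑ y, c x * h (x - y) * c y ≥ 0`. -/
def IsPosSemidefFun {d : ℕ} (h : EuclideanSpace ℝ (Fin d) → ℝ) : Prop :=
  (Matrix.of fun x y : EuclideanSpace ℝ (Fin d) => h (x - y)).PosSemidef

/-- A stationary real-valued kernel, as a function of the lag `τ = x - y`: the covariance function
of a weakly stationary, mean square continuous real process. -/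
structure IsStationaryKernel {d : ℕ} (k : EuclideanSpace ℝ (Fin d) → ℝ) : Prop where
  continuous : Continuous k
  posSemidef : IsPosSemidefFun k

/-- The entrywise product of two vectors. -/
def hadamard {d : ℕ} (τ γ : EuclideanSpace ℝ (Fin d)) : EuclideanSpace ℝ (Fin d) :=
  WithLp.toLp 2 fun i => τ i * γ i

/-- The open positive orthant. -/
def posOrthant (d : ℕ) : Set (EuclideanSpace ℝ (Fin d)) :=
  {v | ∀ i, 0 < v i}

/-- The functions `τ ↦ ∑ k < K, α k * h (τ ⊙ γ k) * cos (2π ⟨ω k, τ⟩)` with `K ≥ 1`, coefficients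
`α k` in `A`, frequencies `ω k` in `Ω` and inverse scales `γ k` in the positive orthant. -/
def spectralFamily {d : ℕ} (A : Set ℝ) (Ω : Set (EuclideanSpace ℝ (Fin d)))
    (h : EuclideanSpace ℝ (Fin d) → ℝ) : Set (EuclideanSpace ℝ (Fin d) → ℝ) :=
  {g | ∃ (K : ℕ) (α : Fin K → ℝ) (ω γ : Fin K → EuclideanSpace ℝ (Fin d)),
    1 ≤ K ∧ (∀ k, α k ∈ A) ∧ (∀ k, ω k ∈ Ω) ∧ (∀ k, γ k ∈ posOrthant d) ∧
    ∀ τ, g τ = ∑ k, α k * h (hadamard τ (γ k)) * Real.cos (2 * Real.pi * inner ℝ (ω k) τ)}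

/-- `G` is dense in the stationary real-valued kernels for pointwise convergence: each of these
kernels is the pointwise limit of a sequence of elements of `G`. -/
def DenseInStationaryKernels {d : ℕ} (G : Set (EuclideanSpace ℝ (Fin d) → ℝ)) : Prop :=
  ∀ k : EuclideanSpace ℝ (Fin d) → ℝ, IsStationaryKernel k →
    ∃ g : ℕ → EuclideanSpace ℝ (Fin d) → ℝ, (∀ n, g n ∈ G) ∧
      ∀ τ, Filter.Tendsto (fun n => g n τ) Filter.atTop (nhds (k τ))

/-- The Gaussian kernel that generates the spectral mixture kernels. -/
def gaussianKernel (d : ℕ) (τ : EuclideanSpace ℝ (Fin d)) : ℝ :=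
  Real.exp (-2 * Real.pi ^ 2 * ‖τ‖ ^ 2)

/-- The modified Bessel function of the second kind `K_ν` at `x > 0`. -/
def besselK (ν x : ℝ) : ℝ :=
  ∫ t in Set.Ioi (0 : ℝ), Real.exp (-x * Real.cosh t) * Real.cosh (ν * t)

/-- The Matérn kernel of smoothness `ν > 0`. At `τ = 0`, where `K_ν` has a pole, the formula is read
as its limit `1`. -/
def maternKernel (d : ℕ) (ν : ℝ) (τ : EuclideanSpace ℝ (Fin d)) : ℝ :=
  if τ = 0 then 1
  else 1 / (Real.Gamma ν * 2 ^ (ν - 1)) * (‖τ‖ * √(2 * ν)) ^ ν * besselK ν (‖τ‖ * √(2 * ν))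

end SpectralKernels

end

/-
Both parts reduce to sums of cosine waves: as the inverse scales tend to zero, `h (τ ⊙ γ) / h 0`
tends to `1`, so only continuity of `h` at `0` and the value `h 0` matter. For the Matérn kernel,
continuity at `0` follows from the integral representation of `x ^ ν * K_ν x` by dominated
convergence.

To approximate a stationary kernel `k` by nonnegative combinations of waves, take the Fejér mean of
`k` over a box of `n ^ d` points of the lattice `δ ℤ ^ d`. Positive semi-definiteness makes its
Fourier coefficients nonnegative, and orthogonality of the characters of `ZMod (2 * n) ^ d` turns
it into a finite sum of waves which agrees on the lattice points of `[-δn, δn] ^ d` with `k` damped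
by `∏ i, (1 - |z i| / n)`. The frequencies lie in the cube of side `1 / δ`, so the oscillation of
this sum between neighbouring lattice points is controlled by its increments along the basis
vectors, which tend to zero because `k` is continuous at `0`. Hence the sums converge off the
lattice too when `δ → 0` and `δ n → ∞`.

Waves of the allowed frequencies generate all waves in the compact-open topology: directly when
`Ω ∪ -Ω` is dense, since the cosine is even; and, with real coefficients, when `Ω` has an interior
point, since `ω ↦ wave ω` is analytic, so that a closed subspace which contains its values near one
point contains them all.
-/

noncomputable section

namespace SpectralKernels

open Filter MeasureTheory Set Topology
open scoped NNReal Pointwise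

section Wave

variable {V : Type*} [NormedAddCommGroup V] [InnerProductSpace ℝ V]

/-- The cosine wave `τ ↦ cos (2π ⟨ω, τ⟩)` of frequency `ω`. -/
def wave (ω : V) : C(V, ℝ) where
  toFun τ := Real.cos (2 * Real.pi * inner ℝ ω τ)

@[simp]
theorem wave_apply (ω τ : V) : wave ω τ = Real.cos (2 * Real.pi * inner ℝ ω τ) := rfl

theorem wave_neg (ω : V) : wave (-ω) = wave ω := by
  ext τ
  simp

theorem continuous_wave : Continuous (wave : V → C(V, ℝ)) :=
  ContinuousMap.continuous_of_continuous_uncurry _ <| by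
    simp only [Function.uncurry_def, wave_apply]
    fun_prop

/-- The `R`-linear span of the waves with frequencies in `Ω`, as a subspace of the space of
continuous functions with the compact-open topology. For `R = ℝ≥0` it is the convex cone they
generate. -/
def waveSpan (R : Type*) [Semiring R] [Module R ℝ] [ContinuousConstSMul R ℝ] (Ω : Set V) :
    Submodule R C(V, ℝ) :=
  Submodule.span R (wave '' Ω)

theorem waveSpan_mono (R : Type*) [Semiring R] [Module R ℝ] [ContinuousConstSMul R ℝ]
    {Ω Ω' : Set V} (hΩ : Ω ⊆ Ω') : waveSpan R Ω ≤ waveSpan R Ω' :=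
  Submodule.span_mono (image_mono hΩ)

theorem waveSpan_nnreal_subset_waveSpan_real (Ω : Set V) :
    (waveSpan ℝ≥0 Ω : Set C(V, ℝ)) ⊆ waveSpan ℝ Ω :=
  Submodule.span_subset_span ℝ≥0 ℝ _

theorem waveSpan_nnreal_univ_le_closure {Ω : Set V} (hΩ : Dense (Ω ∪ -Ω)) :
    waveSpan ℝ≥0 (univ : Set V) ≤ (waveSpan ℝ≥0 Ω).topologicalClosure := by
  refine Submodule.span_le.2 (image_subset_iff.2 fun ω _ => ?_)
  refine map_mem_closure continuous_wave (hΩ ω) ?_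
  rintro ω (hω | hω)
  · exact Submodule.subset_span (mem_image_of_mem _ hω)
  · rw [← wave_neg]
    exact Submodule.subset_span (mem_image_of_mem _ hω)

theorem mem_closure_iff_forall_isCompact {X Y : Type*} [TopologicalSpace X] [PseudoMetricSpace Y]
    {S : Set C(X, Y)} {f : C(X, Y)} :
    f ∈ closure S ↔ ∀ K, IsCompact K → ∀ ε > 0, ∃ g ∈ S, ∀ x ∈ K, dist (g x) (f x) < ε := by
  rw [mem_closure_iff_nhds_basis
    (nhds_basis_uniformity Metric.uniformity_basis_dist.compactConvergenceUniformity)]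
  simp only [Prod.forall, and_imp, mem_ofPred_eq]
  exact forall_congr' fun K => forall_comm

theorem mem_of_analyticOnNhd_of_nonempty_interior {E F : Type*} [NormedAddCommGroup E]
    [NormedSpace ℝ E] [NormedAddCommGroup F] [NormedSpace ℝ F] {f : E → F}
    (hf : AnalyticOnNhd ℝ f univ) {W : Submodule ℝ F} (hW : IsClosed (W : Set F)) {U : Set E}
    (hU : (interior U).Nonempty) (hfU : ∀ x ∈ U, f x ∈ W) (x : E) : f x ∈ W := by
  obtain ⟨x₀, hx₀⟩ := hU
  have : IsClosed (W : Set F) := hW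
  have hq : AnalyticOnNhd ℝ (fun y => W.mkQL (f y)) univ := fun y hy =>
    (W.mkQL.analyticAt _).comp (hf y hy)
  have hzero : (fun y => W.mkQL (f y)) =ᶠ[𝓝 x₀] 0 := by
    filter_upwards [mem_interior_iff_mem_nhds.1 hx₀] with y hy
    simpa using hfU y hy
  simpa using hq.eqOn_zero_of_preconnected_of_eventuallyEq_zero isPreconnected_univ (mem_univ x₀)
    hzero (mem_univ x)

variable [FiniteDimensional ℝ V]

theorem analyticOnNhd_restrict_wave (K : Set V) [CompactSpace K] :
    AnalyticOnNhd ℝ (fun ω : V => (wave ω).restrict K) univ := by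
  -- `wave ω` is the real part of `exp (L ω)`, where the exponential of `C(K, ℂ)` is entire.
  let L : V →ₗ[ℝ] C(K, ℂ) :=
    { toFun := fun ω => ⟨fun τ => ((2 * Real.pi * inner ℝ ω (τ : V) : ℝ) : ℂ) * Complex.I,
        by fun_prop⟩
      map_add' := fun ω ω' => by ext τ; simp [inner_add_left, mul_add, add_mul]
      map_smul' := fun c ω => by ext τ; simp [inner_smul_left]; ring }
  have hL (ω : V) (τ : K) : NormedSpace.exp (L ω) τ = Complex.exp (L ω τ) := by
    rw [Complex.exp_eq_exp_ℂ]
    exact NormedSpace.map_exp (ContinuousMap.evalAlgHom ℂ ℂ τ)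
      (continuous_eval_const τ) (L ω)
  have hexp : AnalyticOnNhd ℝ (fun ω => NormedSpace.exp (L ω)) univ := fun ω _ =>
    (NormedSpace.exp_analytic (L ω)).comp (L.toContinuousLinearMap.analyticAt ω)
  convert (Complex.reCLM.compLeftContinuous ℝ K).comp_analyticOnNhd hexp using 1
  ext ω τ
  exact (Complex.exp_ofReal_mul_I_re _).symm.trans (congrArg Complex.re (hL ω τ).symm)

theorem waveSpan_real_univ_le_closure {Ω : Set V} (hΩ : (interior Ω).Nonempty) :
    waveSpan ℝ (univ : Set V) ≤ (waveSpan ℝ Ω).topologicalClosure := by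
  refine Submodule.span_le.2 (image_subset_iff.2 fun ω _ => ?_)
  refine mem_closure_iff_forall_isCompact.2 fun K hK ε hε => ?_
  have : CompactSpace K := isCompact_iff_compactSpace.1 hK
  let W := ((waveSpan ℝ Ω).map
    (ContinuousMap.compCLM ℝ ℝ (ContinuousMap.id V |>.restrict K)).toLinearMap).topologicalClosure
  have hW : (wave ω).restrict K ∈ W :=
    mem_of_analyticOnNhd_of_nonempty_interior (analyticOnNhd_restrict_wave K)
      (Submodule.isClosed_topologicalClosure _) hΩ (fun ω hω => subset_closure
        (mem_image_of_mem _ (Submodule.subset_span (mem_image_of_mem _ hω)))) ω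
  obtain ⟨_, ⟨g, hg, rfl⟩, hgω⟩ := Metric.mem_closure_iff.1 hW ε hε
  refine ⟨g, hg, fun τ hτ => ?_⟩
  rw [dist_comm]
  exact (ContinuousMap.dist_lt_iff hε).1 hgω ⟨τ, hτ⟩

end Wave

section SpectralFamily

variable {d : ℕ} {A : Set ℝ} {Ω : Set (EuclideanSpace ℝ (Fin d))}
  {G G' : Set (EuclideanSpace ℝ (Fin d) → ℝ)} {h : EuclideanSpace ℝ (Fin d) → ℝ}

theorem hadamard_toLp_const (τ : EuclideanSpace ℝ (Fin d)) (c : ℝ) :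
    hadamard τ (WithLp.toLp 2 fun _ => c) = c • τ := by
  ext i
  simp [hadamard, mul_comm]

theorem DenseInStationaryKernels.mono (hG : DenseInStationaryKernels G) (hGG' : G ⊆ G') :
    DenseInStationaryKernels G' := fun k hk =>
  let ⟨g, hg, hlim⟩ := hG k hk
  ⟨g, fun n => hGG' (hg n), hlim⟩

theorem DenseInStationaryKernels.of_closure {S : Set C(EuclideanSpace ℝ (Fin d), ℝ)}
    (hS : DenseInStationaryKernels ((⇑) '' closure S)) : DenseInStationaryKernels ((⇑) '' S) := by
  intro k hk
  obtain ⟨g, hg, hlim⟩ := hS k hk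
  choose f hf hfg using hg
  have happrox (n : ℕ) := mem_closure_iff_forall_isCompact.1 (hf n) _
    (isCompact_closedBall (0 : EuclideanSpace ℝ (Fin d)) n) (1 / (n + 1)) (by positivity)
  choose F hF hFf using happrox
  refine ⟨fun n => F n, fun n => mem_image_of_mem _ (hF n), fun τ => ?_⟩
  have hdist : Tendsto (fun n => dist (g n τ) (F n τ)) atTop (𝓝 0) := by
    refine squeeze_zero' (.of_forall fun n => dist_nonneg) ?_
      (tendsto_one_div_add_atTop_nhds_zero_nat (𝕜 := ℝ))
    filter_upwards [eventually_ge_atTop ⌈‖τ‖⌉₊] with n hn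
    rw [dist_comm, ← hfg n]
    exact (hFf n τ (mem_closedBall_zero_iff.2 (Nat.ceil_le.1 hn))).le
  exact (tendsto_iff_of_dist hdist).1 (hlim τ)

theorem smul_wave_add_mem_spectralFamily {a : ℝ} (ha : a ∈ A) {ω : EuclideanSpace ℝ (Fin d)}
    (hω : ω ∈ Ω) {g : EuclideanSpace ℝ (Fin d) → ℝ} (hg : g ∈ spectralFamily A Ω 1) :
    a • ⇑(wave ω) + g ∈ spectralFamily A Ω 1 := by
  obtain ⟨K, α, ω', γ, -, hα, hω', hγ, hg⟩ := hg
  refine ⟨K + 1, Fin.cons a α, Fin.cons ω ω', Fin.cons (WithLp.toLp 2 fun _ => 1) γ, by omega,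
    Fin.cases ha hα, Fin.cases hω hω', Fin.cases (fun _ => one_pos) hγ, fun τ => ?_⟩
  simp [hg τ, Fin.sum_univ_succ]

theorem add_mem_spectralFamily_of_mem_waveSpan {R : Type*} [Semiring R] [Module R ℝ]
    [ContinuousConstSMul R ℝ] [IsScalarTower R ℝ ℝ] (hA : ∀ r : R, r ≠ 0 → r • (1 : ℝ) ∈ A)
    {F : C(EuclideanSpace ℝ (Fin d), ℝ)} (hF : F ∈ waveSpan R Ω)
    {g : EuclideanSpace ℝ (Fin d) → ℝ} (hg : g ∈ spectralFamily A Ω 1) :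
    ⇑F + g ∈ spectralFamily A Ω 1 := by
  induction hF using Submodule.closure_induction generalizing g with
  | zero => simpa using hg
  | add F F' _ _ hF hF' =>
    rw [ContinuousMap.coe_add, add_assoc]
    exact hF (hF' hg)
  | smul_mem r F hF =>
    obtain ⟨ω, hω, rfl⟩ := hF
    rcases eq_or_ne r 0 with rfl | hr
    · simpa using hg
    · rw [ContinuousMap.coe_smul, ← smul_one_smul ℝ r]
      exact smul_wave_add_mem_spectralFamily (hA r hr) hω hg

theorem DenseInStationaryKernels.spectralFamily_one {R : Type*} [Semiring R] [Module R ℝ]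
    [ContinuousConstSMul R ℝ] [IsScalarTower R ℝ ℝ] (hΩ : Ω.Nonempty)
    (hA : ∀ r : R, r ≠ 0 → r • (1 : ℝ) ∈ A) (hA' : Ioi 0 ⊆ A)
    (hdense : DenseInStationaryKernels
      ((⇑) '' (waveSpan R Ω : Set C(EuclideanSpace ℝ (Fin d), ℝ)))) :
    DenseInStationaryKernels (spectralFamily A Ω 1) := by
  intro k hk
  obtain ⟨g, hg, hlim⟩ := hdense k hk
  obtain ⟨ω, hω⟩ := hΩ
  -- A multiple of `wave ω` tending to zero rules out the empty sum, excluded by `1 ≤ K`.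
  let ε (n : ℕ) : EuclideanSpace ℝ (Fin d) → ℝ := fun τ => 1 / ((n : ℝ) + 1) * wave ω τ
  refine ⟨fun n => g n + ε n, fun n => ?_, fun τ => ?_⟩
  · obtain ⟨F, hF, hFg⟩ := hg n
    simp only [← hFg]
    refine add_mem_spectralFamily_of_mem_waveSpan hA hF
      ⟨1, fun _ => 1 / ((n : ℝ) + 1), fun _ => ω, fun _ => WithLp.toLp 2 fun _ => 1, le_rfl,
        fun _ => hA' (mem_Ioi.2 (by positivity)), fun _ => hω, fun _ _ => one_pos, fun τ => ?_⟩
    simp [ε]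
  · simpa [ε] using (hlim τ).add
      ((tendsto_one_div_add_atTop_nhds_zero_nat (𝕜 := ℝ)).mul_const (wave ω τ))

-- The inverse scales may tend to zero, which turns the factor `h` into the constant `h 0`.
theorem DenseInStationaryKernels.spectralFamily_of_one (hcont : ContinuousAt h 0) (h0 : h 0 ≠ 0)
    (hA : ∀ a ∈ A, a / h 0 ∈ A) (hdense : DenseInStationaryKernels (spectralFamily A Ω 1)) :
    DenseInStationaryKernels (spectralFamily A Ω h) := by
  intro k hk
  obtain ⟨g, hg, hlim⟩ := hdense k hk
  choose K α ω _ hK hα hω _ hgeq using hg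
  let c (n : ℕ) : ℝ := 1 / ((n : ℝ) + 1)
  refine ⟨fun n τ => h (c n • τ) / h 0 * g n τ, fun n => ?_, fun τ => ?_⟩
  · refine ⟨K n, fun j => α n j / h 0, ω n, fun _ => WithLp.toLp 2 fun _ => c n, hK n,
      fun j => hA _ (hα n j), hω n, fun _ _ => Nat.one_div_pos_of_nat, fun τ => ?_⟩
    simp only [hgeq, Finset.mul_sum]
    refine Finset.sum_congr rfl fun j _ => ?_
    rw [hadamard_toLp_const, Pi.one_apply]
    ring
  · have hscale : Tendsto (fun n => h (c n • τ)) atTop (𝓝 (h 0)) := by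
      refine hcont.tendsto.comp ?_
      simpa [c] using (tendsto_one_div_add_atTop_nhds_zero_nat (𝕜 := ℝ)).smul_const τ
    simpa [h0] using (hscale.div_const (h 0)).mul (hlim τ)

end SpectralFamily

section Fejer

open Finset ComplexOrder

theorem posSemidef_map_ofReal {ι : Type*} [Finite ι] {M : Matrix ι ι ℝ} (hM : M.PosSemidef) :
    (M.map ((↑) : ℝ → ℂ)).PosSemidef := by
  classical
  have := Fintype.ofFinite ι
  open scoped MatrixOrder Matrix.Norms.L2Operator in
  obtain ⟨B, rfl⟩ := CStarAlgebra.nonneg_iff_eq_star_mul_self.1 hM.nonneg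
  convert Matrix.posSemidef_conjTranspose_mul_self (B.map ((↑) : ℝ → ℂ)) using 1
  ext i j
  simp [Matrix.mul_apply]

section Character

variable {Γ : Type*} [AddCommGroup Γ]

/-- The Fourier coefficient at the character `ψ` of the Fejér mean of `f` over the finite set `S`,
that is, of `z ↦ (#(S ∩ (S + z)) / #S) * f z`. -/
def fejerWeight (f : Γ → ℝ) (S : Finset Γ) (ψ : AddChar Γ ℂ) : ℂ :=
  (∑ x ∈ S, ∑ y ∈ S, f (x - y) * ψ (y - x)) / #S

theorem fejerWeight_nonneg {f : Γ → ℝ} (hf : (Matrix.of fun x y => f (x - y)).PosSemidef)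
    (S : Finset Γ) {ψ : AddChar Γ ℂ} (hψ : ∀ x, ‖ψ x‖ = 1) : 0 ≤ fejerWeight f S ψ := by
  have hquad := (posSemidef_map_ofReal
    (hf.submatrix ((↑) : S → Γ))).dotProduct_mulVec_nonneg fun x => ψ x
  refine div_nonneg (hquad.trans_eq ?_) (Nat.cast_nonneg _)
  simp only [dotProduct, Matrix.mulVec, Matrix.map_apply, Matrix.submatrix_apply, Matrix.of_apply,
    Pi.star_apply, mul_sum]
  rw [← sum_coe_sort S]
  refine sum_congr rfl fun x _ => ?_
  rw [← sum_coe_sort S]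
  refine sum_congr rfl fun y _ => ?_
  rw [AddChar.map_sub_eq_div, div_eq_mul_inv, RCLike.inv_eq_conj (hψ x), starRingEnd_apply]
  ring

theorem sum_fejerWeight_mul {G : Type*} [AddCommGroup G] [Fintype G] (φ : Γ →+ G) (f : Γ → ℝ)
    (S : Finset Γ) [DecidableEq Γ] {z : Γ} (hz : ∀ x ∈ S, ∀ y ∈ S, φ (x - y) = φ z → x - y = z) :
    ∑ χ : AddChar G ℂ, fejerWeight f S (χ.compAddMonoidHom φ) * χ (φ z) =
      Fintype.card G * (#{x ∈ S | x - z ∈ S} / #S * f z) := by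
  classical
  have horth (x y : Γ) (hx : x ∈ S) (hy : y ∈ S) :
      ∑ χ : AddChar G ℂ, χ (φ (y - x)) * χ (φ z) =
        if x - z = y then (Fintype.card G : ℂ) else 0 := by
    simp only [← AddChar.map_add_eq_mul, AddChar.sum_apply_eq_ite]
    refine if_congr ⟨fun h => ?_, fun h => ?_⟩ rfl rfl
    · rw [← hz x hx y hy (by rw [← neg_sub, map_neg, neg_eq_of_add_eq_zero_right h]),
        sub_sub_cancel]
    · rw [← map_add, ← h, sub_sub_cancel_left, neg_add_cancel, map_zero]
  calc _ = (∑ x ∈ S, ∑ y ∈ S, f (x - y) * ∑ χ : AddChar G ℂ, χ (φ (y - x)) * χ (φ z)) / #S := by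
        simp only [fejerWeight, AddChar.compAddMonoidHom_apply, div_mul_eq_mul_div, ← sum_div,
          sum_mul, mul_sum, mul_assoc]
        rw [sum_comm]
        exact congrArg (· / _) (sum_congr rfl fun x _ => sum_comm)
    _ = (∑ x ∈ S, if x - z ∈ S then (f z * Fintype.card G : ℂ) else 0) / #S := by
        refine congrArg (· / _) (sum_congr rfl fun x hx => ?_)
        rw [sum_congr rfl fun y hy => by rw [horth x y hx hy]]
        simp
    _ = _ := by
        rw [← sum_filter, sum_const, nsmul_eq_mul]
        ring

theorem sum_re_fejerWeight_mul_re {G : Type*} [AddCommGroup G] [Fintype G] (φ : Γ →+ G)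
    {f : Γ → ℝ} (hf : (Matrix.of fun x y => f (x - y)).PosSemidef) (S : Finset Γ) [DecidableEq Γ]
    {z : Γ} (hz : ∀ x ∈ S, ∀ y ∈ S, φ (x - y) = φ z → x - y = z) :
    ∑ χ : AddChar G ℂ, (fejerWeight f S (χ.compAddMonoidHom φ)).re * (χ (φ z)).re =
      Fintype.card G * (#{x ∈ S | x - z ∈ S} / #S * f z) := by
  have hre (χ : AddChar G ℂ) : (fejerWeight f S (χ.compAddMonoidHom φ)).re * (χ (φ z)).re =
      (fejerWeight f S (χ.compAddMonoidHom φ) * χ (φ z)).re := by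
    have hnonneg : 0 ≤ fejerWeight f S (χ.compAddMonoidHom φ) :=
      fejerWeight_nonneg hf S fun x => χ.norm_apply (φ x)
    rw [Complex.mul_re, ← (Complex.nonneg_iff.1 hnonneg).2, zero_mul, sub_zero]
  rw [sum_congr rfl fun χ _ => hre χ, ← Complex.re_sum, sum_fejerWeight_mul φ f S hz]
  convert Complex.ofReal_re (Fintype.card G * (#{x ∈ S | x - z ∈ S} / #S * f z)) using 2
  push_cast
  rfl

theorem apply_eq_exp_arg {ι : Type*} [Fintype ι] [DecidableEq ι] {ψ : AddChar (ι → ℤ) ℂ}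
    (hψ : ∀ x, ‖ψ x‖ = 1) (z : ι → ℤ) :
    ψ z = Complex.exp ((∑ i, (ψ (Pi.single i 1)).arg * z i : ℝ) * Complex.I) := by
  have hbasis (i : ι) :
      ψ (Pi.single i (z i)) = Complex.exp (((ψ (Pi.single i 1)).arg * z i : ℝ) * Complex.I) := by
    have : Pi.single i (z i) = z i • (Pi.single i 1 : ι → ℤ) := by simp [← Pi.single_smul]
    rw [this, AddChar.map_zsmul_eq_zpow]
    nth_rw 1 [← Complex.norm_mul_exp_arg_mul_I (ψ (Pi.single i 1))]
    rw [hψ, Complex.ofReal_one, one_mul, ← Complex.exp_int_mul]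
    push_cast
    ring_nf
  calc ψ z = ψ (∑ i, Pi.single i (z i)) := by rw [univ_sum_single]
    _ = ∏ i, ψ (Pi.single i (z i)) :=
        map_prod ψ.toMonoidHom (fun i => Multiplicative.ofAdd (Pi.single i (z i))) univ
    _ = _ := by
        rw [prod_congr rfl fun i _ => hbasis i, ← Complex.exp_sum, ← sum_mul,
          ← Complex.ofReal_sum]

end Character

section Box

/-- The lattice box `[0, n)^ι`, over which the Fejér means are taken. -/
def box (ι : Type*) [Fintype ι] [DecidableEq ι] (n : ℕ) : Finset (ι → ℤ) :=
  Fintype.piFinset fun _ => Finset.Ico 0 (n : ℤ)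

theorem card_filter_sub_mem_Ico {n : ℕ} {z : ℤ} (hz : |z| ≤ n) :
    (#{a ∈ Finset.Ico 0 (n : ℤ) | a - z ∈ Finset.Ico 0 (n : ℤ)} : ℤ) = n - |z| := by
  have heq : {a ∈ Finset.Ico 0 (n : ℤ) | a - z ∈ Finset.Ico 0 (n : ℤ)} =
      Finset.Ico (max 0 z) (min n (n + z)) := by
    ext a
    simp only [mem_filter, Finset.mem_Ico]
    omega
  rw [heq, Int.card_Ico]
  rcases abs_cases z with ⟨h, _⟩ | ⟨h, _⟩ <;> rw [h] at hz ⊢ <;> omega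

variable {ι : Type*} [Fintype ι] [DecidableEq ι] {n : ℕ}

theorem card_filter_sub_mem_box_div {z : ι → ℤ} (hn : 0 < n) (hz : ∀ i, |z i| ≤ n) :
    (#{x ∈ box ι n | x - z ∈ box ι n} / #(box ι n) : ℝ) = ∏ i, (1 - |(z i : ℝ)| / n) := by
  have heq : {x ∈ box ι n | x - z ∈ box ι n} =
      Fintype.piFinset fun i => {a ∈ Finset.Ico 0 (n : ℤ) | a - z i ∈ Finset.Ico 0 (n : ℤ)} := by
    ext x
    simp [box, Fintype.mem_piFinset, forall_and]
  have hcard (i : ι) :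
      (#{a ∈ Finset.Ico 0 (n : ℤ) | a - z i ∈ Finset.Ico 0 (n : ℤ)} : ℝ) = n - |(z i : ℝ)| :=
    mod_cast card_filter_sub_mem_Ico (hz i)
  rw [heq, box, Fintype.card_piFinset, Fintype.card_piFinset, Nat.cast_prod, Nat.cast_prod,
    ← prod_div_distrib]
  refine prod_congr rfl fun i _ => ?_
  rw [hcard, Int.card_Ico, sub_zero, Int.toNat_natCast, sub_div, div_self (by positivity)]

theorem sub_eq_of_intCast_eq {x y z : ι → ℤ} (hx : x ∈ box ι n) (hy : y ∈ box ι n)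
    (hz : ∀ i, |z i| ≤ n) (h : ∀ i, ((x - y) i : ZMod (2 * n)) = z i) : x - y = z := by
  funext i
  have hx := Finset.mem_Ico.1 (Fintype.mem_piFinset.1 hx i)
  have hy := Finset.mem_Ico.1 (Fintype.mem_piFinset.1 hy i)
  have hz := abs_le.1 (hz i)
  have hdvd := (ZMod.intCast_eq_intCast_iff_dvd_sub _ _ _).1 (h i)
  have hzero := Int.eq_zero_of_abs_lt_dvd hdvd <| abs_lt.2 <| by
    push_cast
    simp only [Pi.sub_apply]
    omega
  omega

end Box

section Lattice

variable {d : ℕ}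

/-- The homomorphism `z ↦ δ • z` from `ℤ^d` onto the lattice of mesh `δ`. -/
def latticeHom (d : ℕ) (δ : ℝ) : (Fin d → ℤ) →+ EuclideanSpace ℝ (Fin d) where
  toFun z := WithLp.toLp 2 fun i => δ * z i
  map_zero' := by ext; simp
  map_add' x y := by ext; simp [mul_add]

@[simp]
theorem latticeHom_apply (δ : ℝ) (z : Fin d → ℤ) (i : Fin d) : latticeHom d δ z i = δ * z i := rfl

/-- The frequencies `ω` in the cube of side `1 / δ`, for which every coordinate `ω i` undergoes at
most half a period over the distance `δ`. -/
def frequencyCube (d : ℕ) (δ : ℝ) : Set (EuclideanSpace ℝ (Fin d)) :=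
  {ω | ∀ i, |2 * Real.pi * ω i * δ| ≤ Real.pi}

theorem exists_wave_latticeHom_eq_re {δ : ℝ} (hδ : δ ≠ 0) {ψ : AddChar (Fin d → ℤ) ℂ}
    (hψ : ∀ x, ‖ψ x‖ = 1) :
    ∃ ω ∈ frequencyCube d δ, ∀ z, wave ω (latticeHom d δ z) = (ψ z).re := by
  refine ⟨WithLp.toLp 2 fun i => (ψ (Pi.single i 1)).arg / (2 * Real.pi * δ), fun i => ?_,
    fun z => ?_⟩
  · convert Complex.abs_arg_le_pi (ψ (Pi.single i 1)) using 2
    field_simp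
  · rw [apply_eq_exp_arg hψ, Complex.exp_ofReal_mul_I_re, wave_apply, PiLp.inner_apply, mul_sum]
    refine congrArg Real.cos (sum_congr rfl fun i _ => ?_)
    simp only [latticeHom_apply, RCLike.inner_apply, conj_trivial]
    field_simp

theorem IsPosSemidefFun.exists_mem_waveSpan_eq_on_lattice {k : EuclideanSpace ℝ (Fin d) → ℝ}
    (hk : IsPosSemidefFun k) {δ : ℝ} (hδ : δ ≠ 0) {n : ℕ} (hn : 0 < n) :
    ∃ F ∈ waveSpan ℝ≥0 (frequencyCube d δ), ∀ z : Fin d → ℤ, (∀ i, |z i| ≤ n) →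
      F (latticeHom d δ z) = (∏ i, (1 - |(z i : ℝ)| / n)) * k (latticeHom d δ z) := by
  have : NeZero (2 * n) := ⟨by omega⟩
  let φ : (Fin d → ℤ) →+ (Fin d → ZMod (2 * n)) := (Int.castAddHom (ZMod (2 * n))).compLeft (Fin d)
  let w (χ : AddChar (Fin d → ZMod (2 * n)) ℂ) : ℂ :=
    fejerWeight (k ∘ latticeHom d δ) (box (Fin d) n) (χ.compAddMonoidHom φ)
  have hf : (Matrix.of fun x y => (k ∘ latticeHom d δ) (x - y)).PosSemidef := by
    simpa [Matrix.submatrix] using hk.submatrix (latticeHom d δ)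
  choose ω hω hωχ using fun χ : AddChar (Fin d → ZMod (2 * n)) ℂ =>
    exists_wave_latticeHom_eq_re hδ (ψ := χ.compAddMonoidHom φ) fun x => χ.norm_apply (φ x)
  let N : ℝ := Fintype.card (Fin d → ZMod (2 * n))
  have hN : N ≠ 0 := Nat.cast_ne_zero.2 Fintype.card_ne_zero
  have hw (χ) : 0 ≤ (w χ).re / N := div_nonneg
    (Complex.nonneg_iff.1 (fejerWeight_nonneg hf _ fun x => χ.norm_apply (φ x))).1
    (Nat.cast_nonneg _)
  refine ⟨∑ χ, (⟨(w χ).re / N, hw χ⟩ : ℝ≥0) • wave (ω χ), Submodule.sum_mem _ fun χ _ =>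
    Submodule.smul_mem _ _ (Submodule.subset_span (mem_image_of_mem _ (hω χ))), fun z hz => ?_⟩
  have hinv : ∑ χ, (w χ).re * (χ (φ z)).re = N * _ := sum_re_fejerWeight_mul_re φ hf
    (box (Fin d) n) fun x hx y hy h => sub_eq_of_intCast_eq hx hy hz (congrFun h)
  calc (∑ χ, (⟨(w χ).re / N, hw χ⟩ : ℝ≥0) • wave (ω χ)) (latticeHom d δ z)
      = (∑ χ, (w χ).re * (χ (φ z)).re) / N := by
        rw [ContinuousMap.sum_apply, sum_div]
        refine sum_congr rfl fun χ _ => ?_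
        rw [ContinuousMap.smul_apply, hωχ]
        exact div_mul_eq_mul_div _ _ _
    _ = _ := by
        rw [hinv, mul_div_cancel_left₀ _ hN, card_filter_sub_mem_box_div hn hz]
        rfl

end Lattice

end Fejer

section Convergence

variable {d : ℕ}

theorem abs_le_add_div_mul_one_sub_cos {x ε : ℝ} (hx : |x| ≤ Real.pi) (hε : 0 < ε) :
    |x| ≤ ε + Real.pi ^ 2 / (8 * ε) * (1 - Real.cos x) := by
  have hcos := Real.cos_le_one_sub_mul_cos_sq hx
  calc |x| ≤ ε + x ^ 2 / (4 * ε) := by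
        rw [← sq_abs x, ← sub_nonneg]
        have : ε + |x| ^ 2 / (4 * ε) - |x| = (|x| - 2 * ε) ^ 2 / (4 * ε) := by
          field_simp
          ring
        rw [this]
        positivity
    _ = ε + Real.pi ^ 2 / (8 * ε) * (2 / Real.pi ^ 2 * x ^ 2) := by
        field_simp
        ring
    _ ≤ _ := by
        gcongr
        linarith

theorem abs_wave_sub_wave_le {δ ε : ℝ} (hε : 0 < ε) {ω u v : EuclideanSpace ℝ (Fin d)}
    (hω : ω ∈ frequencyCube d δ) (huv : ∀ i, |u i - v i| ≤ δ) :
    |wave ω u - wave ω v| ≤ ∑ i, (ε * wave ω 0 + Real.pi ^ 2 / (8 * ε) *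
      (wave ω 0 - wave ω (latticeHom d δ (Pi.single i 1)))) := by
  have hbasis (i : Fin d) : wave ω (latticeHom d δ (Pi.single i 1)) =
      Real.cos (2 * Real.pi * ω i * δ) := by
    have : latticeHom d δ (Pi.single i 1) = EuclideanSpace.single i δ := by
      ext j
      rcases eq_or_ne j i with rfl | hj <;> simp [*]
    rw [this, wave_apply, EuclideanSpace.inner_single_right]
    simp [mul_comm δ, mul_assoc]
  calc |wave ω u - wave ω v|
      ≤ |2 * Real.pi * inner ℝ ω u - 2 * Real.pi * inner ℝ ω v| := Real.abs_cos_sub_cos_le _ _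
    _ = |∑ i, 2 * Real.pi * ω i * (u i - v i)| := by
        rw [← mul_sub, ← inner_sub_right, PiLp.inner_apply, Finset.mul_sum]
        simp only [PiLp.sub_apply, RCLike.inner_apply, conj_trivial, mul_assoc,
          mul_comm (ω.ofLp _)]
    _ ≤ ∑ i, |2 * Real.pi * ω i * δ| := by
        refine (Finset.abs_sum_le_sum_abs _ _).trans (Finset.sum_le_sum fun i _ => ?_)
        rw [abs_mul, abs_mul _ δ]
        exact mul_le_mul_of_nonneg_left ((huv i).trans (le_abs_self δ)) (abs_nonneg _)
    _ ≤ _ := by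
        refine Finset.sum_le_sum fun i _ => ?_
        simpa [hbasis] using abs_le_add_div_mul_one_sub_cos (hω i) hε

-- The bound of `abs_wave_sub_wave_le` is linear in the wave, so it passes to the cone.
theorem abs_sub_le_of_mem_waveSpan {δ ε : ℝ} (hε : 0 < ε) {F : C(EuclideanSpace ℝ (Fin d), ℝ)}
    (hF : F ∈ waveSpan ℝ≥0 (frequencyCube d δ)) {u v : EuclideanSpace ℝ (Fin d)}
    (huv : ∀ i, |u i - v i| ≤ δ) :
    |F u - F v| ≤ ∑ i, (ε * F 0 + Real.pi ^ 2 / (8 * ε) *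
      (F 0 - F (latticeHom d δ (Pi.single i 1)))) := by
  induction hF using Submodule.span_induction with
  | mem _ hω =>
    obtain ⟨ω, hω, rfl⟩ := hω
    exact abs_wave_sub_wave_le hε hω huv
  | zero => simp
  | add F G _ _ hF hG =>
    simp only [ContinuousMap.add_apply, add_sub_add_comm]
    refine (abs_add_le _ _).trans ((add_le_add hF hG).trans_eq ?_)
    rw [← Finset.sum_add_distrib]
    exact Finset.sum_congr rfl fun i _ => by ring
  | smul c F _ hF =>
    simp only [ContinuousMap.smul_apply, NNReal.smul_def, smul_eq_mul, ← mul_sub, abs_mul,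
      NNReal.abs_eq]
    refine (mul_le_mul_of_nonneg_left hF c.coe_nonneg).trans_eq ?_
    rw [Finset.mul_sum]
    exact Finset.sum_congr rfl fun i _ => by ring

variable {δ : ℕ → ℝ} {n : ℕ → ℕ} {F : ℕ → C(EuclideanSpace ℝ (Fin d), ℝ)}
  {k : EuclideanSpace ℝ (Fin d) → ℝ} {τ : EuclideanSpace ℝ (Fin d)}

theorem tendsto_intCast_div_zero (hδn : Tendsto (fun m => δ m * n m) atTop atTop)
    (hδ : ∀ m, 0 < δ m) {z : ℕ → Fin d → ℤ}
    (hz : Tendsto (fun m => latticeHom d (δ m) (z m)) atTop (𝓝 τ)) (i : Fin d) :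
    Tendsto (fun m => |(z m i : ℝ)| / n m) atTop (𝓝 0) := by
  have hzi : Tendsto (fun m => δ m * z m i) atTop (𝓝 (τ i)) :=
    ((PiLp.continuous_apply 2 _ i).tendsto τ).comp hz
  refine (hzi.abs.div_atTop hδn).congr fun m => ?_
  rw [abs_mul, abs_of_pos (hδ m), mul_div_mul_left _ _ (hδ m).ne']

theorem tendsto_apply_latticeHom (hk : Continuous k) (hδ : ∀ m, 0 < δ m) (hn : ∀ m, 0 < n m)
    (hδn : Tendsto (fun m => δ m * n m) atTop atTop)
    (hF : ∀ m, ∀ z : Fin d → ℤ, (∀ i, |z i| ≤ n m) → F m (latticeHom d (δ m) z) =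
      (∏ i, (1 - |(z i : ℝ)| / n m)) * k (latticeHom d (δ m) z)) {z : ℕ → Fin d → ℤ}
    (hz : Tendsto (fun m => latticeHom d (δ m) (z m)) atTop (𝓝 τ)) :
    Tendsto (fun m => F m (latticeHom d (δ m) (z m))) atTop (𝓝 (k τ)) := by
  have hratio := tendsto_intCast_div_zero hδn hδ hz
  have hprod : Tendsto (fun m => ∏ i, (1 - |(z m i : ℝ)| / n m)) atTop (𝓝 1) := by
    simpa using tendsto_finsetProd Finset.univ fun i _ => (hratio i).const_sub 1
  have hlim := hprod.mul ((hk.tendsto τ).comp hz)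
  rw [one_mul] at hlim
  refine hlim.congr' ?_
  filter_upwards [eventually_all.2 fun i => (hratio i).eventually_lt_const one_pos] with m hm
  refine (hF m (z m) fun i => ?_).symm
  have := (div_lt_one (Nat.cast_pos.2 (hn m))).1 (hm i)
  exact_mod_cast this.le

theorem abs_floor_div_mul_sub_le {δ : ℝ} (hδ : 0 < δ) (t : ℝ) : |δ * ⌊t / δ⌋ - t| ≤ δ := by
  have hfloor := Int.self_sub_floor (t / δ)
  calc |δ * ⌊t / δ⌋ - t| = |δ * Int.fract (t / δ)| := by
        rw [← hfloor, mul_sub, mul_div_cancel₀ _ hδ.ne', abs_sub_comm]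
    _ = δ * Int.fract (t / δ) := abs_of_nonneg (mul_nonneg hδ.le (Int.fract_nonneg _))
    _ ≤ δ := mul_le_of_le_one_right hδ.le (Int.fract_lt_one _).le

theorem tendsto_latticeHom_floor (hδ : ∀ m, 0 < δ m) (hδ0 : Tendsto δ atTop (𝓝 0))
    (τ : EuclideanSpace ℝ (Fin d)) :
    Tendsto (fun m => latticeHom d (δ m) fun i => ⌊τ i / δ m⌋) atTop (𝓝 τ) := by
  have hcoord : Tendsto (fun m i => δ m * ⌊τ i / δ m⌋) atTop (𝓝 fun i => τ i) :=
    tendsto_pi_nhds.2 fun i => tendsto_iff_dist_tendsto_zero.2 <|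
      squeeze_zero (fun _ => dist_nonneg) (fun m => abs_floor_div_mul_sub_le (hδ m) (τ i)) hδ0
  exact ((PiLp.continuous_toLp 2 _).tendsto _).comp hcoord

theorem tendsto_latticeHom_const (hδ0 : Tendsto δ atTop (𝓝 0)) (z : Fin d → ℤ) :
    Tendsto (fun m => latticeHom d (δ m) z) atTop (𝓝 0) := by
  have hsmul (m : ℕ) : latticeHom d (δ m) z = δ m • latticeHom d 1 z := by
    ext i
    simp
  simpa [hsmul] using hδ0.smul_const (latticeHom d 1 z)

theorem tendsto_apply_of_tendsto_apply_latticeHom (hδ : ∀ m, 0 < δ m) (hδ0 : Tendsto δ atTop (𝓝 0))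
    (hF : ∀ m, F m ∈ waveSpan ℝ≥0 (frequencyCube d (δ m)))
    (hlim : ∀ (z : ℕ → Fin d → ℤ) τ, Tendsto (fun m => latticeHom d (δ m) (z m)) atTop (𝓝 τ) →
      Tendsto (fun m => F m (latticeHom d (δ m) (z m))) atTop (𝓝 (k τ)))
    (τ : EuclideanSpace ℝ (Fin d)) : Tendsto (fun m => F m τ) atTop (𝓝 (k τ)) := by
  have hzero : Tendsto (fun m => F m 0) atTop (𝓝 (k 0)) := by
    simpa using hlim (fun _ => 0) 0 (tendsto_latticeHom_const hδ0 0)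
  have hbasis (i : Fin d) :=
    hlim (fun _ => Pi.single i 1) 0 (tendsto_latticeHom_const hδ0 _)
  let E (ε : ℝ) (m : ℕ) : ℝ := ∑ i, (ε * F m 0 + Real.pi ^ 2 / (8 * ε) *
    (F m 0 - F m (latticeHom d (δ m) (Pi.single i 1))))
  have hE (ε : ℝ) : Tendsto (E ε) atTop (𝓝 (d * (ε * k 0))) := by
    simpa using tendsto_finsetSum Finset.univ fun i _ =>
      (hzero.const_mul ε).add ((hzero.sub (hbasis i)).const_mul (Real.pi ^ 2 / (8 * ε)))
  refine (tendsto_iff_of_dist (Metric.tendsto_nhds.2 fun η hη => ?_)).1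
    (hlim _ τ (tendsto_latticeHom_floor hδ hδ0 τ))
  obtain ⟨ε, hεη, hε⟩ : ∃ ε : ℝ, d * (ε * k 0) < η ∧ 0 < ε := by
    have : Tendsto (fun ε : ℝ => d * (ε * k 0)) (𝓝[>] 0) (𝓝 0) :=
      tendsto_nhdsWithin_of_tendsto_nhds <| (by fun_prop : Continuous _).tendsto' _ _ (by simp)
    exact ((this.eventually_lt_const hη).and self_mem_nhdsWithin).exists
  filter_upwards [(hE ε).eventually_lt_const hεη] with m hm
  rw [Real.dist_0_eq_abs, abs_of_nonneg dist_nonneg]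
  exact (abs_sub_le_of_mem_waveSpan hε (hF m) fun i => abs_floor_div_mul_sub_le (hδ m) _).trans_lt
    hm

theorem denseInStationaryKernels_waveSpan (d : ℕ) : DenseInStationaryKernels
    ((⇑) '' (waveSpan ℝ≥0 (univ : Set (EuclideanSpace ℝ (Fin d))) :
      Set C(EuclideanSpace ℝ (Fin d), ℝ))) := by
  intro k hk
  let δ (m : ℕ) : ℝ := 1 / (m + 1)
  let n (m : ℕ) : ℕ := (m + 1) ^ 2
  have hδ (m) : 0 < δ m := Nat.one_div_pos_of_nat
  have hn (m) : 0 < n m := by positivity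
  have hδn : Tendsto (fun m => δ m * n m) atTop atTop := by
    refine (tendsto_atTop_add_const_right _ (1 : ℝ) tendsto_natCast_atTop_atTop).congr fun m => ?_
    simp only [δ, n]
    push_cast
    field_simp
  choose F hF hFk using fun m =>
    hk.posSemidef.exists_mem_waveSpan_eq_on_lattice (hδ m).ne' (hn m)
  exact ⟨fun m => F m, fun m => mem_image_of_mem _ (waveSpan_mono ℝ≥0 (subset_univ _) (hF m)),
    tendsto_apply_of_tendsto_apply_latticeHom hδ tendsto_one_div_add_atTop_nhds_zero_nat hF
      fun _ _ hz => tendsto_apply_latticeHom hk.continuous hδ hn hδn hFk hz⟩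

end Convergence

section Substitution

variable {E : Type*} [NormedAddCommGroup E] [NormedSpace ℝ E] {c : ℝ}

theorem image_mul_exp_univ (hc : 0 < c) : (fun t => c * Real.exp t) '' univ = Ioi 0 := by
  rw [image_univ, ← Function.comp_def (c * ·), range_comp, Real.range_exp, image_mul_left_Ioi hc,
    mul_zero]

theorem injOn_mul_exp (hc : 0 < c) : InjOn (fun t => c * Real.exp t) univ :=
  ((mul_right_injective₀ hc.ne').comp Real.exp_injective).injOn

theorem hasDerivWithinAt_mul_exp (c t : ℝ) :
    HasDerivWithinAt (fun t => c * Real.exp t) (c * Real.exp t) univ t :=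
  ((Real.hasDerivAt_exp t).const_mul c).hasDerivWithinAt

theorem integrable_comp_mul_exp (hc : 0 < c) (g : ℝ → E) :
    Integrable (fun t => (c * Real.exp t) • g (c * Real.exp t)) ↔ IntegrableOn g (Ioi 0) := by
  rw [← image_mul_exp_univ hc, integrableOn_image_iff_integrableOn_abs_deriv_smul .univ
    (fun t _ => hasDerivWithinAt_mul_exp c t) (injOn_mul_exp hc), integrableOn_univ]
  simp only [abs_of_pos (mul_pos hc (Real.exp_pos _))]

theorem integral_comp_mul_exp (hc : 0 < c) (g : ℝ → E) :
    ∫ t, (c * Real.exp t) • g (c * Real.exp t) = ∫ u in Ioi 0, g u := by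
  rw [← image_mul_exp_univ hc, integral_image_eq_integral_abs_deriv_smul .univ
    (fun t _ => hasDerivWithinAt_mul_exp c t) (injOn_mul_exp hc), setIntegral_univ]
  simp only [abs_of_pos (mul_pos hc (Real.exp_pos _))]

end Substitution

section Matern

variable {ν x u : ℝ}

/-- The integrand of `x ^ ν * K_ν x = 2 ^ (ν - 1) * ∫ u in Ioi 0, besselIntegrand ν x u`, obtained
from `besselK` by the substitution `u = (x / 2) * exp t`. At `x = 0` it is the integrand of
`Γ ν`. -/
def besselIntegrand (ν x u : ℝ) : ℝ :=
  Real.exp (-x ^ 2 / (4 * u)) * (Real.exp (-u) * u ^ (ν - 1))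

theorem measurable_besselIntegrand (ν x : ℝ) : Measurable (besselIntegrand ν x) := by
  unfold besselIntegrand
  fun_prop

theorem norm_besselIntegrand_le (ν x : ℝ) (hu : 0 < u) :
    ‖besselIntegrand ν x u‖ ≤ Real.exp (-u) * u ^ (ν - 1) := by
  rw [besselIntegrand, Real.norm_of_nonneg (by positivity)]
  refine mul_le_of_le_one_left (by positivity) (Real.exp_le_one_iff.2 ?_)
  rw [neg_div]
  exact neg_nonpos.2 (by positivity)

theorem integrableOn_besselIntegrand (hν : 0 < ν) (x : ℝ) :
    IntegrableOn (besselIntegrand ν x) (Ioi 0) :=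
  (Real.GammaIntegral_convergent hν).mono' (measurable_besselIntegrand ν x).aestronglyMeasurable <|
    ae_restrict_of_forall_mem measurableSet_Ioi fun _ hu => norm_besselIntegrand_le ν x hu

theorem tendsto_integral_besselIntegrand (hν : 0 < ν) :
    Tendsto (fun x => ∫ u in Ioi 0, besselIntegrand ν x u) (𝓝 0) (𝓝 (Real.Gamma ν)) := by
  rw [Real.Gamma_eq_integral hν]
  refine tendsto_integral_filter_of_dominated_convergence _
    (.of_forall fun x => (measurable_besselIntegrand ν x).aestronglyMeasurable)
    (.of_forall fun x => ae_restrict_of_forall_mem measurableSet_Ioi fun u hu =>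
      norm_besselIntegrand_le ν x hu)
    (Real.GammaIntegral_convergent hν) (.of_forall fun u => ?_)
  have : Continuous fun x => besselIntegrand ν x u := by
    unfold besselIntegrand
    fun_prop
  exact this.tendsto' _ _ (by simp [besselIntegrand])

theorem mul_besselIntegrand_mul_exp (hx : 0 < x) (ν t : ℝ) :
    x / 2 * Real.exp t * besselIntegrand ν x (x / 2 * Real.exp t) =
      (x / 2) ^ ν * (Real.exp (-x * Real.cosh t) * Real.exp (ν * t)) := by
  set u := x / 2 * Real.exp t with hu
  have hu0 : 0 < u := by positivity
  have hexp : Real.exp (-x ^ 2 / (4 * u)) * Real.exp (-u) = Real.exp (-x * Real.cosh t) := by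
    rw [← Real.exp_add, hu, Real.cosh_eq, Real.exp_neg]
    congr 1
    field_simp
    ring
  have hpow : u * u ^ (ν - 1) = (x / 2) ^ ν * Real.exp (ν * t) := by
    rw [mul_comm u, Real.rpow_sub_one hu0.ne', div_mul_cancel₀ _ hu0.ne',
      Real.mul_rpow (by positivity) (Real.exp_pos t).le, ← Real.exp_mul, mul_comm t]
  calc u * besselIntegrand ν x u
      = Real.exp (-x ^ 2 / (4 * u)) * Real.exp (-u) * (u * u ^ (ν - 1)) := by
        rw [besselIntegrand]
        ring
    _ = _ := by
        rw [hexp, hpow]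
        ring

theorem integrable_exp_cosh_mul_exp (hν : 0 < ν) (hx : 0 < x) :
    Integrable fun t => Real.exp (-x * Real.cosh t) * Real.exp (ν * t) := by
  have hsubst := (integrable_comp_mul_exp (half_pos hx) _).2 (integrableOn_besselIntegrand hν x)
  simp only [smul_eq_mul, mul_besselIntegrand_mul_exp hx] at hsubst
  exact (integrable_const_mul_iff (by positivity : (x / 2) ^ ν ≠ 0).isUnit _).1 hsubst

theorem besselK_eq_integral_exp (hν : 0 < ν) (hx : 0 < x) :
    besselK ν x = (∫ t, Real.exp (-x * Real.cosh t) * Real.exp (ν * t)) / 2 := by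
  let f (t : ℝ) : ℝ := Real.exp (-x * Real.cosh t) * Real.exp (ν * t)
  have hf : Integrable f := integrable_exp_cosh_mul_exp hν hx
  have hsymm (t : ℝ) : Real.exp (-x * Real.cosh |t|) * Real.cosh (ν * |t|) =
      (f t + f (-t)) / 2 := by
    rw [← Real.cosh_abs (ν * |t|), abs_mul, abs_abs, ← abs_mul, Real.cosh_abs, Real.cosh_abs,
      Real.cosh_eq (ν * t)]
    simp only [f, Real.cosh_neg, mul_neg]
    ring
  have habs := integral_comp_abs (f := fun t => Real.exp (-x * Real.cosh t) * Real.cosh (ν * t))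
  simp only [hsymm] at habs
  rw [integral_div, integral_add hf hf.comp_neg, integral_neg_eq_self f] at habs
  rw [besselK]
  linarith

theorem rpow_mul_besselK (hν : 0 < ν) (hx : 0 < x) :
    x ^ ν * besselK ν x = 2 ^ (ν - 1) * ∫ u in Ioi 0, besselIntegrand ν x u := by
  have hsubst := integral_comp_mul_exp (half_pos hx) (besselIntegrand ν x)
  simp only [smul_eq_mul, mul_besselIntegrand_mul_exp hx, integral_const_mul] at hsubst
  rw [besselK_eq_integral_exp hν hx, ← hsubst, Real.div_rpow hx.le zero_le_two,
    Real.rpow_sub_one two_ne_zero]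
  field_simp

theorem tendsto_rpow_mul_besselK (hν : 0 < ν) :
    Tendsto (fun x => x ^ ν * besselK ν x) (𝓝[>] 0) (𝓝 (Real.Gamma ν * 2 ^ (ν - 1))) := by
  rw [mul_comm]
  refine (((tendsto_integral_besselIntegrand hν).const_mul _).mono_left
    nhdsWithin_le_nhds).congr' ?_
  filter_upwards [self_mem_nhdsWithin] with x hx
  exact (rpow_mul_besselK hν hx).symm

theorem maternKernel_zero (d : ℕ) (ν : ℝ) : maternKernel d ν 0 = 1 := if_pos rfl

theorem continuousAt_maternKernel_zero (d : ℕ) (hν : 0 < ν) :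
    ContinuousAt (maternKernel d ν) 0 := by
  rw [continuousAt_iff_punctured_nhds, maternKernel_zero]
  have hscale : Tendsto (fun τ : EuclideanSpace ℝ (Fin d) => ‖τ‖ * √(2 * ν)) (𝓝[≠] 0) (𝓝[>] 0) := by
    refine tendsto_nhdsWithin_iff.2 ⟨?_, ?_⟩
    · exact tendsto_nhdsWithin_of_tendsto_nhds <|
        (by fun_prop : Continuous _).tendsto' _ _ (by simp)
    · filter_upwards [self_mem_nhdsWithin] with τ hτ
      exact mul_pos (norm_pos_iff.2 hτ) (Real.sqrt_pos.2 (by positivity))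
  have hlim := ((tendsto_rpow_mul_besselK hν).comp hscale).const_mul
    (1 / (Real.Gamma ν * 2 ^ (ν - 1)))
  rw [one_div_mul_cancel (mul_ne_zero (Real.Gamma_pos_of_pos hν).ne' (by positivity))] at hlim
  refine hlim.congr' ?_
  filter_upwards [self_mem_nhdsWithin] with τ hτ
  rw [maternKernel, if_neg (show τ ≠ 0 from hτ), Function.comp, mul_assoc]

end Matern

section Instances

theorem nonempty_interior_posOrthant (d : ℕ) : (interior (posOrthant d)).Nonempty := by
  have hopen : IsOpen (posOrthant d) := by
    simp only [posOrthant, ofPred_forall]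
    exact isOpen_iInter_of_finite fun i => isOpen_lt continuous_const (by fun_prop)
  rw [hopen.interior_eq]
  exact ⟨WithLp.toLp 2 fun _ => 1, fun _ => one_pos⟩

theorem dense_posOrthant_one_union_neg : Dense (posOrthant 1 ∪ -posOrthant 1) := by
  have hcompl : posOrthant 1 ∪ -posOrthant 1 = {0}ᶜ := by
    ext ω
    simp [posOrthant, PiLp.ext_iff, eq_comm]
  rw [hcompl]
  exact dense_compl_singleton 0

theorem gaussianKernel_zero (d : ℕ) : gaussianKernel d 0 = 1 := by simp [gaussianKernel]

theorem continuous_gaussianKernel (d : ℕ) : Continuous (gaussianKernel d) := by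
  unfold gaussianKernel
  fun_prop

theorem continuousAt_zero_and_apply_zero_eq_one {d : ℕ} {h : EuclideanSpace ℝ (Fin d) → ℝ}
    (hh : h = gaussianKernel d ∨ ∃ ν : ℝ, 0 < ν ∧ h = maternKernel d ν) :
    ContinuousAt h 0 ∧ h 0 = 1 := by
  rcases hh with rfl | ⟨ν, hν, rfl⟩
  · exact ⟨(continuous_gaussianKernel d).continuousAt, gaussianKernel_zero d⟩
  · exact ⟨continuousAt_maternKernel_zero d hν, maternKernel_zero d ν⟩

end Instances

end SpectralKernels

end

open SpectralKernels in
theorem theorem2_general {d : ℕ} {h : EuclideanSpace ℝ (Fin d) → ℝ} (hcont : ContinuousAt h 0)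
    {Ω : Set (EuclideanSpace ℝ (Fin d))} :
    (h 0 ≠ 0 → (interior Ω).Nonempty →
      DenseInStationaryKernels (spectralFamily Set.univ Ω h)) ∧
    (0 < h 0 → Dense (Ω ∪ -Ω) →
      DenseInStationaryKernels (spectralFamily (Set.Ioi 0) Ω h)) := by
  refine ⟨fun h0 hΩ => ?_, fun h0 hΩ => ?_⟩
  · have hwaves := ((denseInStationaryKernels_waveSpan d).mono <| Set.image_mono <|
      (waveSpan_nnreal_subset_waveSpan_real _).trans (waveSpan_real_univ_le_closure hΩ)).of_closure
    have hone := hwaves.spectralFamily_one (A := Set.univ) (hΩ.mono interior_subset)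
      (fun _ _ => Set.mem_univ _) (Set.subset_univ _)
    exact hone.spectralFamily_of_one hcont h0 fun _ _ => Set.mem_univ _
  · have hwaves := ((denseInStationaryKernels_waveSpan d).mono <| Set.image_mono <|
      waveSpan_nnreal_univ_le_closure hΩ).of_closure
    have hΩne : Ω.Nonempty := by simpa using hΩ.nonempty
    have hone := hwaves.spectralFamily_one (A := Set.Ioi 0) hΩne
      (fun r hr => by simpa [NNReal.smul_def] using pos_iff_ne_zero.2 hr) subset_rfl
    exact hone.spectralFamily_of_one hcont h0.ne' fun a ha => div_pos ha h0

theorem theorem2 (d : ℕ) :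
    (∀ h : EuclideanSpace ℝ (Fin d) → ℝ,
      SpectralKernels.IsPosSemidefFun h → Continuous h →
      MeasureTheory.Integrable h MeasureTheory.volume → (∀ τ, 0 < h τ) →
      SpectralKernels.DenseInStationaryKernels
        (SpectralKernels.spectralFamily Set.univ (SpectralKernels.posOrthant d) h)) ∧
    (∀ h : EuclideanSpace ℝ (Fin d) → ℝ,
      (h = SpectralKernels.gaussianKernel d ∨
        ∃ ν : ℝ, 0 < ν ∧ h = SpectralKernels.maternKernel d ν) →
      -- real coefficients, frequencies in the positive orthant
      SpectralKernels.DenseInStationaryKernels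
        (SpectralKernels.spectralFamily Set.univ (SpectralKernels.posOrthant d) h) ∧
      -- positive coefficients, frequencies of arbitrary signs
      SpectralKernels.DenseInStationaryKernels
        (SpectralKernels.spectralFamily (Set.Ioi 0) Set.univ h) ∧
      -- positive coefficients, positive frequencies, on the line
      (d = 1 → SpectralKernels.DenseInStationaryKernels
        (SpectralKernels.spectralFamily (Set.Ioi 0) (SpectralKernels.posOrthant d) h))) := by
  have hreal {h : EuclideanSpace ℝ (Fin d) → ℝ} (hcont : ContinuousAt h 0) (h0 : 0 < h 0) :=
    (theorem2_general hcont).1 h0.ne' (SpectralKernels.nonempty_interior_posOrthant d)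
  refine ⟨fun h _ hcont _ hpos => hreal hcont.continuousAt (hpos 0), fun h hh => ?_⟩
  obtain ⟨hcont, hone⟩ := SpectralKernels.continuousAt_zero_and_apply_zero_eq_one hh
  have h0 : 0 < h 0 := hone ▸ one_pos
  refine ⟨hreal hcont h0, (theorem2_general hcont).2 h0 (by simp), ?_⟩
  rintro rfl
  exact (theorem2_general hcont).2 h0 SpectralKernels.dense_posOrthant_one_union_neg
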